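/- Let $(\Sigma_+,\Sigma_-,N_1,N_2,N_3)$, $\tau\in\mathbb{R}$, be a vacuum solution of the Wainwright–Hsu equations \[ N_1'=(q-4\Sigma_+)N_1,\quad N_2'=(q+2\Sigma_++2\sqrt3\,\Sigma_-)N_2,\quad N_3'=(q+2\Sigma_+-2\sqrt3\,\Sigma_-)N_3, \] \[ \Sigma_+'=-(2-q)\Sigma_+-3S_+,\qquad \Sigma_-'=-(2-q)\Sigma_--3S_-, \] where $'=d/d\tau$, $q=2(\Sigma_+^2+\Sigma_-^2)$, $S_+=\tfrac12[(N_2-N_3)^2-N_1(2N_1-N_2-N_3)]$, $S_-=\tfrac{\sqrt3}{2}(N_3-N_2)(N_1-N_2-N_3)$, subject to the constraint \[ \Sigma_+^2+\Sigma_-^2+\tfrac34\big[N_1^2+N_2^2+N_3^2-2(N_1N_2+N_2N_3+N_1N_3)\big]=1 , \] and let it be of Bianchi type VIII: $N_k<0$ for one index $k$ and $N_i>0$ for the two other indices. Let $(\theta,\sigma_i,n_i)$, functions of proper time $t$ in an open interval $I\ni 0$ with $\theta\neq0$ on $I$, be any solution of the diagonal Ellis–MacCallum equations \[ \dot n_i=2n_i\sigma_i-\tfrac13\theta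 n_i,\qquad \dot\sigma_i=-\theta\sigma_i-s_i,\qquad \dot\theta=-\sum_i(\sigma_i+\tfrac13\theta)^2, \] \[ \sum_i\sigma_i=0,\qquad \sum_i\sigma_i^2+\sum_in_i^2-\tfrac12\Big(\sum_in_i\Big)^2=\tfrac23\theta^2, \] with $b_i=2n_i^2-(\sum_jn_j)n_i$ and $s_i=b_i-\tfrac13\sum_jb_j$, which has the given solution as its Wainwright–Hsu variables. That is, there is a function $\tau\mapsto t(\tau)\in I$ on $\mathbb{R}$ with $dt/d\tau=3/\theta$ and $t(0)=0$, and along it $N_i=n_i/\theta$, $\Sigma_+=\tfrac32(\sigma_2+\sigma_3)/\theta$, $\Sigma_-=\tfrac{\sqrt3}{2}(\sigma_2-\sigma_3)/\theta$. Let \[ a_i(t)=\exp\Big(-\int_0^t\big(\sigma_i+\tfrac13\theta\big)\,ds\Big),\qquad i=1,2,3, \] be the functions in the corresponding spacetime metric $-dt^2+\sum_{i=1}^3a_i^{-2}(t)\,\xi^i\otimes\xi^i$ on $I\times G$, where $\xi^i$ is the dual of a basis of the Lie algebra of $G$. Then all three $a_i$, as functions of $\tau$, are bounded on $[0,\infty)$,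 and the two $a_i$ with $i\neq k$ (those with $N_i>0$) converge to $0$ as $\tau\to\infty$. Moreover, if $k=1$, i.e. $N_1<0$ and $N_2,N_3>0$, then $\int_0^\tau(2\Sigma_+-1)\,ds$ is bounded above for $\tau\in[0,\infty)$. -/

import Mathlib

open Filter Topology

namespace BianchiA

/-! The indices `0, 1, 2 : Fin 3` stand for the indices `1, 2, 3` of the mathematical text. -/

/-- The deceleration parameter `q = 2 (Σ₊² + Σ₋²)`. -/
noncomputable def decel (Sp Sm : ℝ) : ℝ := 2 * (Sp ^ 2 + Sm ^ 2)

/-- `S₊ = ½ [(N₂ - N₃)² - N₁ (2 N₁ - N₂ - N₃)]`. -/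
noncomputable def curvPlus (N₁ N₂ N₃ : ℝ) : ℝ :=
  (1 / 2) * ((N₂ - N₃) ^ 2 - N₁ * (2 * N₁ - N₂ - N₃))

/-- `S₋ = (√3 / 2) (N₃ - N₂) (N₁ - N₂ - N₃)`. -/
noncomputable def curvMinus (N₁ N₂ N₃ : ℝ) : ℝ :=
  (Real.sqrt 3 / 2) * (N₃ - N₂) * (N₁ - N₂ - N₃)

/-- `(Σ₊, Σ₋, N₁, N₂, N₃)`, as functions of `τ ∈ (-∞, ∞)`, solve the vacuum equations of
Wainwright and Hsu together with the Hamiltonian constraint. -/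
structure IsWainwrightHsuSolution (Sp Sm : ℝ → ℝ) (N : Fin 3 → ℝ → ℝ) : Prop where
  deriv_N₁ : ∀ τ, HasDerivAt (N 0) ((decel (Sp τ) (Sm τ) - 4 * Sp τ) * N 0 τ) τ
  deriv_N₂ : ∀ τ, HasDerivAt (N 1)
    ((decel (Sp τ) (Sm τ) + 2 * Sp τ + 2 * Real.sqrt 3 * Sm τ) * N 1 τ) τ
  deriv_N₃ : ∀ τ, HasDerivAt (N 2)
    ((decel (Sp τ) (Sm τ) + 2 * Sp τ - 2 * Real.sqrt 3 * Sm τ) * N 2 τ) τ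
  deriv_Sp : ∀ τ, HasDerivAt Sp
    (-(2 - decel (Sp τ) (Sm τ)) * Sp τ - 3 * curvPlus (N 0 τ) (N 1 τ) (N 2 τ)) τ
  deriv_Sm : ∀ τ, HasDerivAt Sm
    (-(2 - decel (Sp τ) (Sm τ)) * Sm τ - 3 * curvMinus (N 0 τ) (N 1 τ) (N 2 τ)) τ
  hamiltonian : ∀ τ, Sp τ ^ 2 + Sm τ ^ 2 + (3 / 4) *
    (N 0 τ ^ 2 + N 1 τ ^ 2 + N 2 τ ^ 2
      - 2 * (N 0 τ * N 1 τ + N 1 τ * N 2 τ + N 0 τ * N 2 τ)) = 1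

/-- The solution is of Bianchi type VIII: one of the `N i`, namely `N k`, is negative and the
other two are positive. -/
def IsBianchiVIII (N : Fin 3 → ℝ → ℝ) (k : Fin 3) : Prop :=
  ∀ τ, N k τ < 0 ∧ ∀ i, i ≠ k → 0 < N i τ

/-- Diagonal elements of `b = 2 n² - tr(n) n` for a diagonal matrix `n`. -/
noncomputable def curvB (n : Fin 3 → ℝ) (i : Fin 3) : ℝ :=
  2 * n i ^ 2 - (∑ j, n j) * n i

/-- Diagonal elements of the trace free part `s = b - (1/3) tr(b) δ` of `b`. -/
noncomputable def curvS (n : Fin 3 → ℝ) (i : Fin 3) : ℝ :=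
  curvB n i - (1 / 3) * ∑ j, curvB n j

/-- The mean curvature `θ` and the diagonal elements `σ i`, `n i` of the trace free matrix `σ`
and of the commutator matrix `n`, as functions of proper time `t` in an open interval
`I` around `0`, solve the diagonal vacuum equations of Ellis and MacCallum: the evolution
equations for `n` and `σ`, the Raychaudhuri equation, in which `θ_{ii} = σ_i + θ/3`, and the
constraint. -/
structure IsEllisMacCallumSolution (I : Set ℝ) (θ : ℝ → ℝ) (σ n : Fin 3 → ℝ → ℝ) : Prop where
  isOpen : IsOpen I
  ordConnected : I.OrdConnected
  zero_mem : (0 : ℝ) ∈ I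
  trace_free : ∀ t ∈ I, ∑ i, σ i t = 0
  deriv_n : ∀ i, ∀ t ∈ I, HasDerivAt (n i) (2 * n i t * σ i t - (1 / 3) * θ t * n i t) t
  deriv_σ : ∀ i, ∀ t ∈ I, HasDerivAt (σ i) (-(θ t * σ i t) - curvS (fun j => n j t) i) t
  raychaudhuri : ∀ t ∈ I, HasDerivAt θ (-∑ i, (σ i t + (1 / 3) * θ t) ^ 2) t
  gauss : ∀ t ∈ I, ∑ i, σ i t ^ 2 + (∑ i, n i t ^ 2 - (1 / 2) * (∑ i, n i t) ^ 2)
    = (2 / 3) * θ t ^ 2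

/-- The functions `a_i(t) = exp (-∫₀ᵗ (σ_i + θ/3) ds)`, the coefficients of the spacetime metric
`-dt² + ∑ a_i(t)⁻² ξⁱ ⊗ ξⁱ` on `I × G`. -/
noncomputable def metricA (θ : ℝ → ℝ) (σ : Fin 3 → ℝ → ℝ) (i : Fin 3) (t : ℝ) : ℝ :=
  Real.exp (-∫ s in (0 : ℝ)..t, (σ i s + (1 / 3) * θ s))

/-- `(Σ₊, Σ₋, N₁, N₂, N₃)` are the Wainwright-Hsu variables of the Ellis-MacCallum solution
`(θ, σ, n)` on `I`, and `T` expresses proper time `t` as a function of the time `τ`: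
`dt/dτ = 3/θ`, `t = 0` at `τ = 0`, `Σ₊ = (3/2) (Σ₂₂ + Σ₃₃)`, `Σ₋ = (√3/2) (Σ₂₂ - Σ₃₃)` where
`Σ_{ij} = σ_{ij}/θ`, and `N_i = n_i/θ`. -/
structure IsDevelopment (Sp Sm : ℝ → ℝ) (N : Fin 3 → ℝ → ℝ)
    (I : Set ℝ) (θ : ℝ → ℝ) (σ n : Fin 3 → ℝ → ℝ) (T : ℝ → ℝ) : Prop where
  ellisMacCallum : IsEllisMacCallumSolution I θ σ n
  theta_ne_zero : ∀ t ∈ I, θ t ≠ 0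
  time_mem : ∀ τ, T τ ∈ I
  time_zero : T 0 = 0
  deriv_time : ∀ τ, HasDerivAt T (3 / θ (T τ)) τ
  Sp_eq : ∀ τ, Sp τ = (3 / 2) * (σ 1 (T τ) / θ (T τ) + σ 2 (T τ) / θ (T τ))
  Sm_eq : ∀ τ, Sm τ = (Real.sqrt 3 / 2) * (σ 1 (T τ) / θ (T τ) - σ 2 (T τ) / θ (T τ))
  N_eq : ∀ i τ, N i τ = n i (T τ) / θ (T τ)

end BianchiA

/-!
Write the evolution equations as `N_i' = (q + p_i) N_i`, where
`p = (-4 Σ₊, 2 Σ₊ + 2√3 Σ₋, 2 Σ₊ - 2√3 Σ₋)`. Then `p_1 + p_2 + p_3 = 0`, `q ≥ p_i² / 8` for each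
`i`, and the metric coefficients satisfy `(log a_i)' = -1 - p_i / 2` in the time `τ`; for `i = 1`
the right hand side is `2 Σ₊ - 1`.

In type VIII, with `N_k < 0 < N_i, N_j`, all terms of the Hamiltonian constraint are nonnegative,
so `-N_k N_i` and `-N_k N_j` are at most `2/3`. The logarithms of these products therefore are
functions bounded above, and they dominate the `log a_i`:

* `(½ log (-N_k N_i) + ½ log (-N_k N_j))' = 2 q + p_k / 2 ≥ -1 - p_k / 2`, because
  `2 q + p_k + 1 ≥ (p_k / 2 + 1)²`. Hence `log a_k` is bounded above
  (`bddAbove_of_hasDerivAt_negative_index`); for `k = 1` this is the bound on `∫ (2 Σ₊ - 1)`.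
* `(log (-N_k N_j))' = 2 q - p_i ≥ (-1 - p_i / 2) + 3 / 4`, because
  `2 q - p_i / 2 + 1 / 4 ≥ (p_i - 1)² / 4`. Hence `log a_i ≤ C - 3 τ / 4`
  (`linear_decay_of_hasDerivAt_positive_index`), and `a_i` decays exponentially.

No information on the asymptotic behaviour of the solution is needed.
-/

namespace BianchiA

/-- The trace free part `p_i` of the logarithmic derivative `q + p_i` of `N_i`. It equals
`6 σ_i / θ`. -/
noncomputable def shearRate (Sp Sm : ℝ) : Fin 3 → ℝ :=
  ![-4 * Sp, 2 * Sp + 2 * Real.sqrt 3 * Sm, 2 * Sp - 2 * Real.sqrt 3 * Sm]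

theorem shearRate_add (x y : ℝ) {i j k : Fin 3} (hij : i ≠ j) (hik : i ≠ k) (hjk : j ≠ k) :
    shearRate x y i + shearRate x y j + shearRate x y k = 0 := by
  fin_cases i <;> fin_cases j <;> fin_cases k <;> simp [shearRate] at hij hik hjk ⊢ <;> ring

theorem sq_shearRate_le (x y : ℝ) (i : Fin 3) : shearRate x y i ^ 2 ≤ 8 * decel x y := by
  have h3 : Real.sqrt 3 ^ 2 = 3 := Real.sq_sqrt (by norm_num)
  -- The differences of the two sides are `16 y²` and `4 (√3 x ∓ y)²`.
  fin_cases i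
  · simp only [shearRate, decel, Fin.zero_eta, Matrix.cons_val_zero]
    nlinarith [sq_nonneg y]
  · simp only [shearRate, decel, Fin.mk_one, Matrix.cons_val_one, Matrix.cons_val_zero]
    linear_combination 4 * sq_nonneg (Real.sqrt 3 * x - y) + (4 * x ^ 2 + 4 * y ^ 2) * h3
  · simp only [shearRate, decel, Fin.reduceFinMk, Matrix.cons_val]
    linear_combination 4 * sq_nonneg (Real.sqrt 3 * x + y) + (4 * x ^ 2 + 4 * y ^ 2) * h3

section WainwrightHsu

variable {Sp Sm : ℝ → ℝ} {N : Fin 3 → ℝ → ℝ}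

theorem IsWainwrightHsuSolution.hasDerivAt_N (hsol : IsWainwrightHsuSolution Sp Sm N)
    (i : Fin 3) (τ : ℝ) :
    HasDerivAt (N i) ((decel (Sp τ) (Sm τ) + shearRate (Sp τ) (Sm τ) i) * N i τ) τ := by
  fin_cases i
  · exact (hsol.deriv_N₁ τ).congr_deriv (by simp [shearRate, sub_eq_add_neg])
  · exact (hsol.deriv_N₂ τ).congr_deriv (by simp [shearRate, sub_eq_add_neg, add_assoc])
  · exact (hsol.deriv_N₃ τ).congr_deriv (by simp [shearRate, sub_eq_add_neg, add_assoc])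

theorem IsWainwrightHsuSolution.hasDerivAt_log_N (hsol : IsWainwrightHsuSolution Sp Sm N)
    {i : Fin 3} {τ : ℝ} (hi : N i τ ≠ 0) :
    HasDerivAt (fun s => Real.log (N i s))
      (decel (Sp τ) (Sm τ) + shearRate (Sp τ) (Sm τ) i) τ :=
  ((hsol.hasDerivAt_N i τ).log hi).congr_deriv (mul_div_cancel_right₀ _ hi)

/-- The Hamiltonian constraint is invariant under permutations of the indices. -/
theorem IsWainwrightHsuSolution.hamiltonian_perm (hsol : IsWainwrightHsuSolution Sp Sm N)
    {i j k : Fin 3} (hij : i ≠ j) (hik : i ≠ k) (hjk : j ≠ k) (τ : ℝ) :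
    Sp τ ^ 2 + Sm τ ^ 2 + (3 / 4) *
      ((N i τ - N j τ) ^ 2 + N k τ ^ 2 - 2 * N k τ * (N i τ + N j τ)) = 1 := by
  have h := hsol.hamiltonian τ
  fin_cases i <;> fin_cases j <;> fin_cases k <;> simp at hij hik hjk ⊢ <;> linear_combination h

/-- Since `Real.log` is even, this bounds `log (-N_k N_i)`, the logarithm of a product which the
constraint bounds by `2/3`. -/
theorem log_N_add_log_N_nonpos (hsol : IsWainwrightHsuSolution Sp Sm N) {i j k : Fin 3}
    (hVIII : IsBianchiVIII N k) (hij : i ≠ j) (hik : i ≠ k) (hjk : j ≠ k) (τ : ℝ) :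
    Real.log (N k τ) + Real.log (N i τ) ≤ 0 := by
  obtain ⟨hk, hpos⟩ := hVIII τ
  have hi := hpos i hik
  have hj := hpos j hjk
  rw [← Real.log_mul hk.ne hi.ne', ← Real.log_neg_eq_log]
  refine Real.log_nonpos (by nlinarith) ?_
  nlinarith [hsol.hamiltonian_perm hij hik hjk τ, sq_nonneg (Sp τ), sq_nonneg (Sm τ),
    sq_nonneg (N i τ - N j τ), sq_nonneg (N k τ), mul_pos (neg_pos.2 hk) hj]

/-- This transfers upper bounds from the logarithms of products of the `N_i`, in the role of `g`,
to the `log a_i`. -/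
theorem exists_le_of_hasDerivAt_le {L g L' g' : ℝ → ℝ} (hL : ∀ τ, HasDerivAt L (L' τ) τ)
    (hg : ∀ τ, HasDerivAt g (g' τ) τ) (hle : ∀ τ, L' τ ≤ g' τ) :
    ∃ C, ∀ τ, 0 ≤ τ → L τ ≤ g τ + C := by
  have hmono : Monotone (g - L) := monotone_of_hasDerivAt_nonneg
    (fun τ => (hg τ).sub (hL τ)) fun τ => sub_nonneg.2 (hle τ)
  refine ⟨L 0 - g 0, fun τ hτ => ?_⟩
  have := hmono hτ
  simp only [Pi.sub_apply] at this
  linarith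

/-- For `L = log a_k` this says that `a_k` is bounded in the future. For `k = 0` it also applies to
the primitive `L` of `2 Σ₊ - 1`, without reference to a spacetime metric. -/
theorem bddAbove_of_hasDerivAt_negative_index (hsol : IsWainwrightHsuSolution Sp Sm N) {k : Fin 3}
    (hVIII : IsBianchiVIII N k) {L : ℝ → ℝ}
    (hL : ∀ τ, HasDerivAt L (-1 - shearRate (Sp τ) (Sm τ) k / 2) τ) :
    ∃ C, ∀ τ, 0 ≤ τ → L τ ≤ C := by
  obtain ⟨i, j, hij, hik, hjk⟩ : ∃ i j : Fin 3, i ≠ j ∧ i ≠ k ∧ j ≠ k := by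
    clear * - k; decide +revert
  have hg (τ : ℝ) := ((hsol.hasDerivAt_log_N (hVIII τ).1.ne).add
    (hsol.hasDerivAt_log_N ((hVIII τ).2 i hik).ne')).add
    ((hsol.hasDerivAt_log_N (hVIII τ).1.ne).add (hsol.hasDerivAt_log_N ((hVIII τ).2 j hjk).ne'))
  obtain ⟨C, hC⟩ := exists_le_of_hasDerivAt_le hL (fun τ => (hg τ).const_mul (1 / 2)) fun τ => by
    nlinarith [shearRate_add (Sp τ) (Sm τ) hij hik hjk, sq_shearRate_le (Sp τ) (Sm τ) k,
      sq_nonneg (shearRate (Sp τ) (Sm τ) k + 2)]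
  refine ⟨C, fun τ hτ => (hC τ hτ).trans ?_⟩
  have h₁ := log_N_add_log_N_nonpos hsol hVIII hij hik hjk τ
  have h₂ := log_N_add_log_N_nonpos hsol hVIII hij.symm hjk hik τ
  simp only [Pi.add_apply]
  linarith

/-- For `L = log a_i` this says that `a_i` decays exponentially if `N_i > 0`. -/
theorem linear_decay_of_hasDerivAt_positive_index (hsol : IsWainwrightHsuSolution Sp Sm N)
    {i k : Fin 3} (hVIII : IsBianchiVIII N k) (hik : i ≠ k) {L : ℝ → ℝ}
    (hL : ∀ τ, HasDerivAt L (-1 - shearRate (Sp τ) (Sm τ) i / 2) τ) :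
    ∃ C, ∀ τ, 0 ≤ τ → L τ ≤ C - 3 / 4 * τ := by
  obtain ⟨j, hij, hjk⟩ : ∃ j : Fin 3, i ≠ j ∧ j ≠ k := by
    clear * - hik; decide +revert
  have hg (τ : ℝ) := (hsol.hasDerivAt_log_N (hVIII τ).1.ne).add
    (hsol.hasDerivAt_log_N ((hVIII τ).2 j hjk).ne')
  obtain ⟨C, hC⟩ := exists_le_of_hasDerivAt_le
    (fun τ => (hL τ).add ((hasDerivAt_id τ).const_mul (3 / 4))) hg fun τ => by
    nlinarith [shearRate_add (Sp τ) (Sm τ) hij hik hjk, sq_shearRate_le (Sp τ) (Sm τ) i,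
      sq_nonneg (shearRate (Sp τ) (Sm τ) i - 1)]
  refine ⟨C, fun τ hτ => ?_⟩
  have h₁ := log_N_add_log_N_nonpos hsol hVIII hij.symm hjk hik τ
  have h₂ := hC τ hτ
  simp only [Pi.add_apply, id] at h₂
  linarith

end WainwrightHsu

section Development

variable {Sp Sm : ℝ → ℝ} {N : Fin 3 → ℝ → ℝ} {I : Set ℝ} {θ : ℝ → ℝ} {σ n : Fin 3 → ℝ → ℝ}
  {T : ℝ → ℝ}

theorem IsDevelopment.shearRate_eq (hdev : IsDevelopment Sp Sm N I θ σ n T) (i : Fin 3) (τ : ℝ) :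
    shearRate (Sp τ) (Sm τ) i = 6 * (σ i (T τ) / θ (T τ)) := by
  have h3 : Real.sqrt 3 ^ 2 = 3 := Real.sq_sqrt (by norm_num)
  have htr : σ 0 (T τ) / θ (T τ) + σ 1 (T τ) / θ (T τ) + σ 2 (T τ) / θ (T τ) = 0 := by
    rw [← add_div, ← add_div, ← Fin.sum_univ_three fun i => σ i (T τ),
      hdev.ellisMacCallum.trace_free _ (hdev.time_mem τ), zero_div]
  have hp := hdev.Sp_eq τ
  have hm := hdev.Sm_eq τ
  fin_cases i
  · simp only [shearRate, Fin.zero_eta, Matrix.cons_val_zero]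
    linear_combination -4 * hp - 6 * htr
  · simp only [shearRate, Fin.mk_one, Matrix.cons_val_one, Matrix.cons_val_zero]
    linear_combination 2 * hp + 2 * Real.sqrt 3 * hm
      + (σ 1 (T τ) / θ (T τ) - σ 2 (T τ) / θ (T τ)) * h3
  · simp only [shearRate, Fin.reduceFinMk, Matrix.cons_val]
    linear_combination 2 * hp - 2 * Real.sqrt 3 * hm
      - (σ 1 (T τ) / θ (T τ) - σ 2 (T τ) / θ (T τ)) * h3

theorem IsEllisMacCallumSolution.hasDerivAt_integral (h : IsEllisMacCallumSolution I θ σ n)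
    (i : Fin 3) {t : ℝ} (ht : t ∈ I) :
    HasDerivAt (fun t => ∫ s in (0 : ℝ)..t, (σ i s + (1 / 3) * θ s))
      (σ i t + (1 / 3) * θ t) t := by
  have hcont : ContinuousOn (fun s => σ i s + (1 / 3) * θ s) I := fun s hs =>
    ((h.deriv_σ i s hs).continuousAt.add
      ((h.raychaudhuri s hs).continuousAt.const_mul (1 / 3))).continuousWithinAt
  exact intervalIntegral.integral_hasDerivAt_right
    (hcont.mono (h.ordConnected.uIcc_subset h.zero_mem ht)).intervalIntegrable
    (hcont.stronglyMeasurableAtFilter h.isOpen t ht) (hcont.continuousAt (h.isOpen.mem_nhds ht))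

/-- In the time `τ`, the logarithm of `a_i` has derivative
`-(σ_i + θ/3) · 3/θ = -1 - 3 σ_i/θ`. -/
theorem IsDevelopment.hasDerivAt_log_metricA (hdev : IsDevelopment Sp Sm N I θ σ n T)
    (i : Fin 3) (τ : ℝ) :
    HasDerivAt (fun τ => Real.log (metricA θ σ i (T τ)))
      (-1 - shearRate (Sp τ) (Sm τ) i / 2) τ := by
  simp only [metricA, Real.log_exp]
  have hθ := hdev.theta_ne_zero _ (hdev.time_mem τ)
  refine (((hdev.ellisMacCallum.hasDerivAt_integral i (hdev.time_mem τ)).comp τ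
    (hdev.deriv_time τ)).neg).congr_deriv ?_
  rw [hdev.shearRate_eq]
  field_simp
  ring

theorem metricA_pos (θ : ℝ → ℝ) (σ : Fin 3 → ℝ → ℝ) (i : Fin 3) (t : ℝ) :
    0 < metricA θ σ i t :=
  Real.exp_pos _

end Development

end BianchiA

open BianchiA in
theorem mainTheorem8 (Sp Sm : ℝ → ℝ) (N : Fin 3 → ℝ → ℝ) (k : Fin 3)
    (hsol : BianchiA.IsWainwrightHsuSolution Sp Sm N)
    (hVIII : BianchiA.IsBianchiVIII N k) :
    (∀ (I : Set ℝ) (θ : ℝ → ℝ) (σ n : Fin 3 → ℝ → ℝ) (T : ℝ → ℝ),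
      BianchiA.IsDevelopment Sp Sm N I θ σ n T →
        (∀ i, ∃ C : ℝ, ∀ τ : ℝ, 0 ≤ τ → BianchiA.metricA θ σ i (T τ) ≤ C) ∧
        (∀ i, i ≠ k → Tendsto (fun τ => BianchiA.metricA θ σ i (T τ)) atTop (𝓝 0))) ∧
    (k = 0 → ∃ C : ℝ, ∀ τ : ℝ, 0 ≤ τ → (∫ s in (0 : ℝ)..τ, (2 * Sp s - 1)) ≤ C) := by
  refine ⟨fun I θ σ n T hdev => ?_, ?_⟩
  · have hdecay (i : Fin 3) (hik : i ≠ k) :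
        ∃ C, ∀ τ, 0 ≤ τ → metricA θ σ i (T τ) ≤ Real.exp (C - 3 / 4 * τ) := by
      obtain ⟨C, hC⟩ := linear_decay_of_hasDerivAt_positive_index hsol hVIII hik
        (hdev.hasDerivAt_log_metricA i)
      exact ⟨C, fun τ hτ => (Real.log_le_iff_le_exp (metricA_pos ..)).1 (hC τ hτ)⟩
    refine ⟨fun i => ?_, fun i hik => ?_⟩
    · rcases eq_or_ne i k with rfl | hik
      · obtain ⟨C, hC⟩ := bddAbove_of_hasDerivAt_negative_index hsol hVIII
          (hdev.hasDerivAt_log_metricA i)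
        exact ⟨Real.exp C, fun τ hτ => (Real.log_le_iff_le_exp (metricA_pos ..)).1 (hC τ hτ)⟩
      · obtain ⟨C, hC⟩ := hdecay i hik
        exact ⟨Real.exp C, fun τ hτ => (hC τ hτ).trans (Real.exp_le_exp.2 (by linarith))⟩
    · obtain ⟨C, hC⟩ := hdecay i hik
      have hlim : Tendsto (fun τ : ℝ => Real.exp (C - 3 / 4 * τ)) atTop (𝓝 0) :=
        Real.tendsto_exp_atBot.comp <| tendsto_atBot_add_const_left _ C <|
          tendsto_neg_atTop_atBot.comp <| tendsto_id.const_mul_atTop (by norm_num)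
      exact squeeze_zero' (Eventually.of_forall fun τ => (metricA_pos ..).le)
        ((eventually_ge_atTop 0).mono hC) hlim
  · rintro rfl
    have hcont : Continuous fun s => 2 * Sp s - 1 :=
      (continuous_iff_continuousAt.2 fun τ => (hsol.deriv_Sp τ).continuousAt).const_mul 2
        |>.sub continuous_const
    refine bddAbove_of_hasDerivAt_negative_index hsol hVIII fun τ =>
      (hcont.integral_hasStrictDerivAt 0 τ).hasDerivAt.congr_deriv ?_
    simp only [shearRate, Matrix.cons_val_zero]
    ring
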